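/- **Theorem 2 (Simple regret lower bound of an arbitrary algorithm).** Let $K\ge 2$ and let the vector of means $\boldsymbol\mu=(\mu_1,\dots,\mu_K)\in[0,1]^K$ of $K$ Bernoulli arms be drawn from a prior $H$. For $i\in[K]$ let $\boldsymbol\mu_{\setminus i}$ be the vector of the means other than $\mu_i$, with marginal law $H_{\setminus i}$, and $\mu^*_{\setminus i}=\max_{j\ne i}\mu_j$; for $i\neq j$ let $\boldsymbol\mu_{\setminus ij}$ be the vector of the means other than $\mu_i,\mu_j$. Suppose that there are conditional probability densities (with respect to Lebesgue measure) $h_i(\mu_i\mid\boldsymbol\mu_{\setminus i})$ of $\mu_i$ given $\boldsymbol\mu_{\setminus i}$ and $h_{ij}(\mu_i,\mu_j\mid\boldsymbol\mu_{\setminus ij})$ of $(\mu_i,\mu_j)$ given $\boldsymbol\mu_{\setminus ij}$ that are uniformly continuous, i.e. for every $\epsilon>0$ there is $\delta>0$, independent of all the means, such that for all $i\ne j$ and all values of the conditioning variables $$|h_i(\mu_i\mid\boldsymbol\mu_{\setminus i})-h_i(\lambda_i\mid\boldsymbol\mu_{\setminus i})|\le\epsilon \quad\text{whenever } |\mu_i-\lambda_i|\le\delta,$$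 $$|h_{ij}(\mu_i,\mu_j\mid\boldsymbol\mu_{\setminus ij})-h_{ij}(\lambda_i,\lambda_j\mid\boldsymbol\mu_{\setminus ij})|\le\epsilon \quad\text{whenever } |\mu_i-\lambda_i|,|\mu_j-\lambda_j|\le\delta.$$ A best-arm-identification algorithm, which may know the number of rounds $T$, the prior $H$ and may randomize, draws in each round $t=1,\dots,T$ an arm $I(t)$ depending on the past draws and rewards, receives a reward $X_{I(t)}(t)\sim\mathrm{Bernoulli}(\mu_{I(t)})$, and after round $T$ recommends an arm $J(T)$. Its Bayesian simple regret is $$\mathrm R_H(T)=\mathbb E_{\boldsymbol\mu\sim H}\Big[\max_{i}\mu_i-\mathbb E_{\boldsymbol\mu}[\mu_{J(T)}]\Big].$$ Then every best-arm-identification algorithm satisfies $$\mathrm R_H(T)\ \ge\ \frac{C_{\mathrm{opt}}}{4.8\,T}-o\!\left(\frac1T\right)\qquad(T\to\infty),\qquad C_{\mathrm{opt}}=\sum_{i=1}^K\int_{[0,1]^{K-1}}\mu^*_{\setminus i}\,(1-\mu^*_{\setminus i})\,h_i(\mu^*_{\setminus i}\mid\boldsymbol\mu_{\setminus i})\,dH_{\setminus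 i}(\boldsymbol\mu_{\setminus i}).$$ -/

import Mathlib

open MeasureTheory Filter Asymptotics
open scoped unitInterval

noncomputable section

/-- A (possibly randomized) best-arm-identification policy for `K` arms. A history is the list of the
past draws (arm, reward), most recent first; the reward `true` stands for `1` and `false` for `0`. -/
structure BAIPolicy (K : ℕ) where
  /-- the law of the arm drawn next, given the history -/
  sample : List (Fin K × Bool) → PMF (Fin K)
  /-- the law of the recommended arm, given the final history -/
  recommend : List (Fin K × Bool) → PMF (Fin K)

/-- A best-arm-identification algorithm: for every horizon `T` (which it may know) a policy. -/
abbrev BAIAlgorithm (K : ℕ) := ℕ → BAIPolicy K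

/-- The Bernoulli law with mean `p`. -/
def rewardLaw (p : I) : PMF Bool :=
  PMF.ofFintype (fun b => ENNReal.ofReal (if b then (p : ℝ) else 1 - p)) (by
    have h0 := p.2.1
    have h1 := p.2.2
    simp only [Fintype.sum_bool, if_true, Bool.false_eq_true, if_false]
    rw [← ENNReal.ofReal_add h0 (by linarith)]
    simp)

namespace BAIPolicy

variable {K : ℕ}

/-- The law of the history after `t` rounds when the arms have means `μ`: in each round an arm is
drawn by the policy and a Bernoulli reward with the mean of that arm is observed. -/
def historyLaw (A : BAIPolicy K) (μ : Fin K → I) : ℕ → PMF (List (Fin K × Bool))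
  | 0 => PMF.pure []
  | t + 1 => (historyLaw A μ t).bind fun h =>
      (A.sample h).bind fun a => (rewardLaw (μ a)).bind fun x => PMF.pure ((a, x) :: h)

/-- The law of the arm recommended after `T` rounds when the arms have means `μ`. -/
def recommendationLaw (A : BAIPolicy K) (μ : Fin K → I) (T : ℕ) : PMF (Fin K) :=
  (A.historyLaw μ T).bind A.recommend

end BAIPolicy

/-- The frequentist simple regret `μ* - 𝔼_μ[μ_{J(T)}]` of the policy used for the horizon `T`. -/
def simpleRegret {K : ℕ} (A : BAIAlgorithm K) (μ : Fin K → I) (T : ℕ) : ℝ :=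
  ((Finset.univ.sup μ : I) : ℝ) -
    ∑ j, (((A T).recommendationLaw μ T) j).toReal * (μ j : ℝ)

/-- The Bayesian simple regret: the expectation of the simple regret when `μ` has law `H`. -/
def bayesSimpleRegret {K : ℕ} (H : Measure (Fin K → I)) (A : BAIAlgorithm K) (T : ℕ) : ℝ :=
  ∫ μ, simpleRegret A μ T ∂H

/-- The means of the arms other than `i`. -/
abbrev OtherMeans {K : ℕ} (i : Fin K) := {k : Fin K // k ≠ i} → I

/-- The means of the arms other than `i` and `j`. -/
abbrev OtherMeans₂ {K : ℕ} (i j : Fin K) := {k : Fin K // k ≠ i ∧ k ≠ j} → I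

/-- The marginal law of the means of the arms other than `i`. -/
def marginalOthers {K : ℕ} (H : Measure (Fin K → I)) (i : Fin K) : Measure (OtherMeans i) :=
  H.map fun μ k => μ k

/-- The marginal law of the means of the arms other than `i` and `j`. -/
def marginalOthers₂ {K : ℕ} (H : Measure (Fin K → I)) (i j : Fin K) : Measure (OtherMeans₂ i j) :=
  H.map fun μ k => μ k

/-- `h x y` is a conditional probability density (with respect to the Lebesgue measure on `[0,1]`)
of the mean `x` of arm `i` given the means `y` of the other arms. -/
structure IsCondDensity {K : ℕ} (H : Measure (Fin K → I)) (i : Fin K)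
    (h : I → OtherMeans i → ℝ) : Prop where
  measurable : Measurable fun p : I × OtherMeans i => h p.1 p.2
  nonneg : ∀ x y, 0 ≤ h x y
  map_eq : H.map (fun μ => (μ i, fun k : {k : Fin K // k ≠ i} => μ k)) =
    ((volume : Measure I).prod (marginalOthers H i)).withDensity
      fun p => ENNReal.ofReal (h p.1 p.2)

/-- `h x x' y` is a conditional probability density (with respect to the Lebesgue measure on
`[0,1]²`) of the means `x, x'` of the arms `i, j` given the means `y` of the other arms. -/
structure IsCondDensity₂ {K : ℕ} (H : Measure (Fin K → I)) (i j : Fin K)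
    (h : I → I → OtherMeans₂ i j → ℝ) : Prop where
  measurable : Measurable fun p : (I × I) × OtherMeans₂ i j => h p.1.1 p.1.2 p.2
  nonneg : ∀ x x' y, 0 ≤ h x x' y
  map_eq : H.map (fun μ => ((μ i, μ j), fun k : {k : Fin K // k ≠ i ∧ k ≠ j} => μ k)) =
    ((volume : Measure (I × I)).prod (marginalOthers₂ H i j)).withDensity
      fun p => ENNReal.ofReal (h p.1.1 p.1.2 p.2)

/-- The regularity condition on the prior `H`: `h₁ i` is a conditional density of the mean of arm
`i`, and `h₂ i j` (for `i ≠ j`) one of the means of the arms `i, j`, given the other means; they are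
uniformly continuous in the former means, uniformly in the latter. -/
structure UniformlyContinuousDensities {K : ℕ} (H : Measure (Fin K → I))
    (h₁ : (i : Fin K) → I → OtherMeans i → ℝ)
    (h₂ : (i j : Fin K) → I → I → OtherMeans₂ i j → ℝ) : Prop where
  density₁ : ∀ i, IsCondDensity H i (h₁ i)
  density₂ : ∀ i j, i ≠ j → IsCondDensity₂ H i j (h₂ i j)
  cont₁ : ∀ ε : ℝ, 0 < ε → ∃ δ : ℝ, 0 < δ ∧ ∀ (i : Fin K) (y : OtherMeans i) (x z : I),
    |(x : ℝ) - z| ≤ δ → |h₁ i x y - h₁ i z y| ≤ ε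
  cont₂ : ∀ ε : ℝ, 0 < ε → ∃ δ : ℝ, 0 < δ ∧ ∀ (i j : Fin K), i ≠ j →
    ∀ (y : OtherMeans₂ i j) (x x' z z' : I),
      |(x : ℝ) - z| ≤ δ → |(x' : ℝ) - z'| ≤ δ → |h₂ i j x x' y - h₂ i j z z' y| ≤ ε

/-- The constant `∑ᵢ ∫ m (1 - m) hᵢ(m | y) dH_{∖i}(y)`, where `m` is the largest entry of `y`. -/
def Copt {K : ℕ} (H : Measure (Fin K → I)) (h₁ : (i : Fin K) → I → OtherMeans i → ℝ) : ℝ :=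
  ∑ i, ∫ y, ((Finset.univ.sup y : I) : ℝ) * (1 - ((Finset.univ.sup y : I) : ℝ)) *
    h₁ i (Finset.univ.sup y) y ∂(marginalOthers H i)

end

/-! The regret comes from vectors of means whose two best entries lie within order `1/√T` of each
other. Let these be `x` at arm `i` and `x'` at arm `j`, and exchange them. The new vector has the
same gap but the other best arm, and by the continuity of `h₂` nearly the same prior density. The
policy can hardly separate the two vectors: however adaptive it is, its two history laws have
Bhattacharyya coefficient at least `ρ ^ T`, where `ρ` is the coefficient of the Bernoulli laws with
means `x` and `x'` (`pow_le_tsum_sqrt_historyLaw`). By Le Cam's inequality the two error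
probabilities add up to at least `ρ ^ (2 * T) / 2` (`pow_le_errorProb_add_errorProb`). Integrating
this against the prior gives `lintegral_gapWeight_le`. An error `ε` in the density costs only `ε /
T`, because the gaps of close pairs integrate to at most `1 / T`.

It remains to evaluate the integral of `gapWeight`. If `m` is the largest other mean and `d = x -
m`, then `ρ ^ (2 * T)` is at least about `1 - T d² / (4 m (1 - m))`, and integrating `d / 2` times
this over the `d > 0` where it is positive gives `m (1 - m) / (2 T)`. Fatou's lemma carries this
local estimate through the integral over the other means. Each pair of arms is met in both orders,
which halves the constant to `Copt / 4`; the slack between 4 and 4.8 pays for the approximations,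
with `5/12` in place of `1/2`. -/

noncomputable section

/-! ### Bhattacharyya coefficients of Bernoulli laws -/

/-- The Bhattacharyya coefficient of two Bernoulli laws. -/
def bernoulliAffinity (p q : ℝ) : ℝ := √(p * q) + √((1 - p) * (1 - q))

theorem bernoulliAffinity_nonneg (p q : ℝ) : 0 ≤ bernoulliAffinity p q :=
  add_nonneg (Real.sqrt_nonneg _) (Real.sqrt_nonneg _)

theorem bernoulliAffinity_comm (p q : ℝ) : bernoulliAffinity p q = bernoulliAffinity q p := by
  simp only [bernoulliAffinity, mul_comm]

theorem bernoulliAffinity_self (p : I) : bernoulliAffinity p p = 1 := by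
  have h0 := p.2.1
  have h1 := p.2.2
  rw [bernoulliAffinity, Real.sqrt_mul_self h0, Real.sqrt_mul_self (by linarith)]
  ring

theorem bernoulliAffinity_le_one (p q : I) : bernoulliAffinity p q ≤ 1 := by
  have h0 := p.2.1
  have h1 := p.2.2
  have k0 := q.2.1
  have k1 := q.2.2
  rw [bernoulliAffinity, Real.sqrt_mul h0, Real.sqrt_mul (by linarith)]
  have a1 := Real.sq_sqrt h0
  have a2 := Real.sq_sqrt k0
  have a3 := Real.sq_sqrt (sub_nonneg.2 h1)
  have a4 := Real.sq_sqrt (sub_nonneg.2 k1)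
  nlinarith [sq_nonneg (√(p : ℝ) - √(q : ℝ)), sq_nonneg (√(1 - (p : ℝ)) - √(1 - (q : ℝ)))]

/-- The Bhattacharyya coefficient of two Bernoulli laws with close means is close to one. -/
theorem one_sub_bernoulliAffinity_le {m x : ℝ} (hm : 0 < m) (hx : x < 1) (hmx : m ≤ x) :
    1 - bernoulliAffinity x m ≤ (x - m) ^ 2 / (8 * (m * (1 - x))) := by
  have hx0 : 0 < x := hm.trans_le hmx
  have hm1 : m < 1 := hmx.trans_lt hx
  rw [bernoulliAffinity, Real.sqrt_mul hx0.le, Real.sqrt_mul (by linarith)]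
  have a1 := Real.sq_sqrt hx0.le
  have a2 := Real.sq_sqrt hm.le
  have a3 := Real.sq_sqrt (sub_nonneg.2 hx.le)
  have a4 := Real.sq_sqrt (sub_nonneg.2 hm1.le)
  have b2 := Real.sqrt_pos.2 hm
  have b3 := Real.sqrt_pos.2 (sub_pos.2 hx)
  have c1 : √m ≤ √x := Real.sqrt_le_sqrt hmx
  have c2 : √(1 - x) ≤ √(1 - m) := Real.sqrt_le_sqrt (by linarith)
  -- One minus the coefficient is half the sum of the squared differences of the roots, bounded here
  -- and in `d2`.
  have d1 : (√x - √m) ^ 2 ≤ (x - m) ^ 2 / (4 * m) := by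
    rw [le_div_iff₀ (by positivity)]
    have : x - m = (√x - √m) * (√x + √m) := by nlinarith
    rw [this, mul_pow]
    refine mul_le_mul_of_nonneg_left ?_ (sq_nonneg _)
    nlinarith
  have d2 : (√(1 - m) - √(1 - x)) ^ 2 ≤ (x - m) ^ 2 / (4 * (1 - x)) := by
    rw [le_div_iff₀ (by linarith)]
    have : x - m = (√(1 - m) - √(1 - x)) * (√(1 - m) + √(1 - x)) := by nlinarith
    rw [this, mul_pow]
    refine mul_le_mul_of_nonneg_left ?_ (sq_nonneg _)
    nlinarith
  -- `1/m + 1/(1-x) = (1 - (x-m)) / (m(1-x))`, and the numerator is at most 1.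
  have e : (x - m) ^ 2 / (4 * m) + (x - m) ^ 2 / (4 * (1 - x)) ≤
      2 * ((x - m) ^ 2 / (8 * (m * (1 - x)))) := by
    have h1x : 0 < 1 - x := by linarith
    have : 2 * ((x - m) ^ 2 / (8 * (m * (1 - x)))) -
        ((x - m) ^ 2 / (4 * m) + (x - m) ^ 2 / (4 * (1 - x))) =
        (x - m) ^ 2 * (x - m) / (4 * m * (1 - x)) := by
      field_simp
      ring
    have h : 0 ≤ (x - m) ^ 2 * (x - m) / (4 * m * (1 - x)) :=
      div_nonneg (mul_nonneg (sq_nonneg _) (by linarith)) (by positivity)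
    linarith
  nlinarith

/-- Bernoulli's inequality. The exponent is `2 * T` because Le Cam's inequality squares the
coefficient of `T` rounds. -/
theorem one_sub_le_bernoulliAffinity_pow {m x : ℝ} (hm : 0 < m) (hx : x < 1) (hmx : m ≤ x)
    (T : ℕ) : 1 - T * (x - m) ^ 2 / (4 * (m * (1 - x))) ≤ bernoulliAffinity x m ^ (2 * T) := by
  have h1 := one_sub_bernoulliAffinity_le hm hx hmx
  have h2 := one_add_mul_le_pow (a := bernoulliAffinity x m - 1)
    (by linarith [bernoulliAffinity_nonneg x m]) (2 * T)
  rw [add_sub_cancel] at h2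
  refine le_trans ?_ h2
  have h3 : T * (x - m) ^ 2 / (4 * (m * (1 - x))) = 2 * T * ((x - m) ^ 2 / (8 * (m * (1 - x)))) := by
    have : 0 < 1 - x := by linarith
    field_simp
    ring
  rw [h3]
  push_cast
  have : (0 : ℝ) ≤ 2 * T := by positivity
  nlinarith

theorem sum_sqrt_rewardLaw (p q : I) :
    ∑ x, (rewardLaw p x * rewardLaw q x) ^ (1 / 2 : ℝ) =
      ENNReal.ofReal (bernoulliAffinity p q) := by
  have h0 := p.2.1
  have h1 : 0 ≤ 1 - (p : ℝ) := sub_nonneg.2 p.2.2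
  have k0 := q.2.1
  have k1 : 0 ≤ 1 - (q : ℝ) := sub_nonneg.2 q.2.2
  simp only [rewardLaw, PMF.ofFintype_apply, Fintype.sum_bool, if_true, Bool.false_eq_true,
    if_false, bernoulliAffinity]
  rw [← ENNReal.ofReal_mul h0, ← ENNReal.ofReal_mul h1,
    ENNReal.ofReal_rpow_of_nonneg (by positivity) (by positivity),
    ENNReal.ofReal_rpow_of_nonneg (by positivity) (by positivity), ← Real.sqrt_eq_rpow,
    ← Real.sqrt_eq_rpow, ENNReal.ofReal_add (Real.sqrt_nonneg _) (Real.sqrt_nonneg _)]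

/-! ### History laws and their Bhattacharyya coefficient -/

namespace BAIPolicy

variable {K : ℕ} (A : BAIPolicy K)

theorem historyLaw_succ_nil (μ : Fin K → I) (t : ℕ) : A.historyLaw μ (t + 1) [] = 0 := by
  simp [historyLaw, PMF.bind_apply, PMF.pure_apply]

theorem historyLaw_succ_cons (μ : Fin K → I) (t : ℕ) (a : Fin K) (x : Bool)
    (h : List (Fin K × Bool)) :
    A.historyLaw μ (t + 1) ((a, x) :: h) =
      A.historyLaw μ t h * (A.sample h a * rewardLaw (μ a) x) := by
  simp only [historyLaw, PMF.bind_apply, PMF.pure_apply]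
  rw [tsum_eq_single h, tsum_eq_single a, tsum_eq_single x]
  · simp
  · intro b hb
    simp [hb.symm]
  · intro b hb
    simp [hb.symm]
  · intro b hb
    simp [hb.symm]

theorem measurable_historyLaw (t : ℕ) (l : List (Fin K × Bool)) :
    Measurable fun μ : Fin K → I => A.historyLaw μ t l := by
  induction t generalizing l with
  | zero => exact measurable_const
  | succ t ih =>
    match l with
    | [] => simp only [historyLaw_succ_nil, measurable_const]
    | (a, x) :: h =>
      simp only [historyLaw_succ_cons]
      refine (ih h).mul (measurable_const.mul ?_)
      simp only [rewardLaw, PMF.ofFintype_apply]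
      cases x <;> simp <;> fun_prop

theorem measurable_recommendationLaw (T : ℕ) (i : Fin K) :
    Measurable fun μ : Fin K → I => A.recommendationLaw μ T i := by
  simp only [recommendationLaw, PMF.bind_apply]
  exact Measurable.tsum fun l => (A.measurable_historyLaw T l).mul_const _

/-- Every arm contributes at least the factor `ρ` to the Bhattacharyya coefficient of the laws of
the history, whatever the policy. -/
theorem pow_le_tsum_sqrt_historyLaw (μ ν : Fin K → I) {ρ : ℝ}
    (hρ : ∀ a, ρ ≤ bernoulliAffinity (μ a) (ν a)) (t : ℕ) :
    ENNReal.ofReal ρ ^ t ≤ ∑' l, (A.historyLaw μ t l * A.historyLaw ν t l) ^ (1 / 2 : ℝ) := by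
  induction t with
  | zero =>
    rw [pow_zero]
    refine le_trans ?_ (ENNReal.le_tsum ([] : List (Fin K × Bool)))
    simp [historyLaw, PMF.pure_apply]
  | succ t ih =>
    have hinj : Function.Injective
        fun q : List (Fin K × Bool) × Fin K × Bool => (q.2.1, q.2.2) :: q.1 := by
      rintro ⟨h, a, x⟩ ⟨h', a', x'⟩ e
      simpa [and_assoc, and_comm] using e
    refine le_trans ?_ (ENNReal.tsum_comp_le_tsum_of_injective hinj _)
    -- The sampling probability is the same under both vectors of means, so its geometric mean is
    -- itself. Summed over arms it is a plain average, and adaptivity plays no role.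
    have key : ∀ (h : List (Fin K × Bool)) (a : Fin K) (x : Bool),
        (A.historyLaw μ (t + 1) ((a, x) :: h) * A.historyLaw ν (t + 1) ((a, x) :: h)) ^ (1 / 2 : ℝ)
          = (A.historyLaw μ t h * A.historyLaw ν t h) ^ (1 / 2 : ℝ) * (A.sample h a *
            (rewardLaw (μ a) x * rewardLaw (ν a) x) ^ (1 / 2 : ℝ)) := by
      intro h a x
      rw [historyLaw_succ_cons, historyLaw_succ_cons]
      have : A.historyLaw μ t h * (A.sample h a * rewardLaw (μ a) x) *
          (A.historyLaw ν t h * (A.sample h a * rewardLaw (ν a) x)) =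
          (A.historyLaw μ t h * A.historyLaw ν t h) *
            (A.sample h a ^ (2 : ℝ) * (rewardLaw (μ a) x * rewardLaw (ν a) x)) := by
        rw [ENNReal.rpow_two]
        ring
      rw [this, ENNReal.mul_rpow_of_nonneg _ _ (by norm_num),
        ENNReal.mul_rpow_of_nonneg (A.sample h a ^ (2 : ℝ)) _ (by norm_num), ← ENNReal.rpow_mul]
      norm_num
    have hstep : ∀ h : List (Fin K × Bool), ENNReal.ofReal ρ ≤
        ∑' a, ∑' x, A.sample h a * (rewardLaw (μ a) x * rewardLaw (ν a) x) ^ (1 / 2 : ℝ) := by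
      intro h
      calc ENNReal.ofReal ρ = ∑' a, A.sample h a * ENNReal.ofReal ρ := by
            rw [ENNReal.tsum_mul_right, PMF.tsum_coe, one_mul]
        _ ≤ _ := by
            refine ENNReal.tsum_le_tsum fun a => ?_
            rw [ENNReal.tsum_mul_left, tsum_fintype, sum_sqrt_rewardLaw]
            gcongr
            exact hρ a
    rw [ENNReal.tsum_prod']
    simp only [ENNReal.tsum_prod', key, ENNReal.tsum_mul_left]
    rw [pow_succ]
    refine (mul_le_mul_left ih _).trans ?_
    rw [← ENNReal.tsum_mul_right]
    refine ENNReal.tsum_le_tsum fun h => mul_le_mul_right ?_ _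
    simpa only [ENNReal.tsum_mul_left] using hstep h

end BAIPolicy

/-! ### Le Cam's inequality and error probabilities -/

theorem ENNReal.two_mul_mul_le_sq_add_sq (a b : ENNReal) : 2 * (a * b) ≤ a ^ 2 + b ^ 2 := by
  rcases eq_or_ne a ⊤ with rfl | ha
  · simp
  rcases eq_or_ne b ⊤ with rfl | hb
  · simp
  lift a to NNReal using ha
  lift b to NNReal using hb
  norm_cast
  rw [← NNReal.coe_le_coe]
  push_cast
  nlinarith [sq_nonneg ((a : ℝ) - b)]

/-- Le Cam's inequality: half the squared Bhattacharyya coefficient bounds the overlap of two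
laws from below. -/
theorem PMF.sq_le_two_mul_tsum_min {α : Type*} (P Q : PMF α) {S : ENNReal} (hS : S ≠ ⊤)
    (h : S ≤ ∑' l, (P l * Q l) ^ (1 / 2 : ℝ)) : S ^ 2 ≤ 2 * ∑' l, min (P l) (Q l) := by
  -- AM-GM applied to `P Q = min * max`, weighted so that summation gives `4 S² ≤ 4 ∑ min + 2 S²`.
  have hpt : ∀ l, 4 * S * (P l * Q l) ^ (1 / 2 : ℝ) ≤
      4 * min (P l) (Q l) + S ^ 2 * (P l + Q l) := by
    intro l
    have h1 := ENNReal.two_mul_mul_le_sq_add_sq (2 * min (P l) (Q l) ^ (1 / 2 : ℝ))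
      (S * max (P l) (Q l) ^ (1 / 2 : ℝ))
    have e : ∀ x : ENNReal, (x ^ (1 / 2 : ℝ)) ^ 2 = x := fun x => by
      rw [← ENNReal.rpow_natCast, ← ENNReal.rpow_mul]
      norm_num
    rw [← min_mul_max (P l) (Q l), ENNReal.mul_rpow_of_nonneg _ _ (by norm_num)]
    calc _ = 2 * (2 * min (P l) (Q l) ^ (1 / 2 : ℝ) * (S * max (P l) (Q l) ^ (1 / 2 : ℝ))) := by
          ring
      _ ≤ _ := h1
      _ = 4 * min (P l) (Q l) + S ^ 2 * max (P l) (Q l) := by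
          rw [mul_pow, mul_pow, e, e]
          norm_num
      _ ≤ _ := by
          gcongr
          exact max_le le_self_add le_add_self
  have hsum := ENNReal.tsum_le_tsum hpt
  rw [ENNReal.tsum_mul_left, ENNReal.tsum_add, ENNReal.tsum_mul_left, ENNReal.tsum_mul_left,
    ENNReal.tsum_add, P.tsum_coe, Q.tsum_coe] at hsum
  have h2 : 4 * S * S ≤ 4 * ∑' l, min (P l) (Q l) + S ^ 2 * (1 + 1) :=
    (mul_le_mul_right h _).trans hsum
  have hm : ∑' l, min (P l) (Q l) ≠ ⊤ :=
    ne_top_of_le_ne_top ENNReal.one_ne_top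
      ((ENNReal.tsum_le_tsum fun l => min_le_left _ _).trans_eq P.tsum_coe)
  lift S to NNReal using hS
  lift (∑' l, min (P l) (Q l)) to NNReal using hm with M
  norm_cast at h2 ⊢
  rw [← NNReal.coe_le_coe] at h2 ⊢
  push_cast at h2 ⊢
  nlinarith

namespace BAIPolicy

variable {K : ℕ} (A : BAIPolicy K)

/-- The probability that arm `i` is not recommended. -/
def errorProb (μ : Fin K → I) (T : ℕ) (i : Fin K) : ENNReal := 1 - A.recommendationLaw μ T i

theorem measurable_errorProb (T : ℕ) (i : Fin K) :
    Measurable fun μ : Fin K → I => A.errorProb μ T i :=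
  measurable_const.sub (A.measurable_recommendationLaw T i)

theorem errorProb_le_one (μ : Fin K → I) (T : ℕ) (i : Fin K) : A.errorProb μ T i ≤ 1 :=
  tsub_le_self

theorem recommendationLaw_le_errorProb (μ : Fin K → I) (T : ℕ) {i j : Fin K} (hij : i ≠ j) :
    A.recommendationLaw μ T i ≤ A.errorProb μ T j := by
  refine ENNReal.le_sub_of_add_le_right (PMF.apply_ne_top _ _) ?_
  rw [← (A.recommendationLaw μ T).tsum_coe, tsum_fintype, ← Finset.sum_pair hij]
  exact Finset.sum_le_sum_of_subset (Finset.subset_univ _)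

/-- Two vectors of means with different best arms cannot both have a small error probability. -/
theorem pow_le_errorProb_add_errorProb (μ ν : Fin K → I) {ρ : ℝ}
    (hρ : ∀ a, ρ ≤ bernoulliAffinity (μ a) (ν a)) (hρ0 : 0 ≤ ρ) (T : ℕ) {i j : Fin K}
    (hij : i ≠ j) :
    ENNReal.ofReal (ρ ^ (2 * T) / 2) ≤ A.errorProb μ T i + A.errorProb ν T j := by
  have h1 := PMF.sq_le_two_mul_tsum_min (A.historyLaw μ T) (A.historyLaw ν T)
    (ENNReal.pow_ne_top ENNReal.ofReal_ne_top) (A.pow_le_tsum_sqrt_historyLaw μ ν hρ T)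
  have h2 : ∑' l, min (A.historyLaw μ T l) (A.historyLaw ν T l) ≤
      A.errorProb μ T i + A.recommendationLaw ν T i := by
    -- The overlap is split according to whether `i` is recommended: the part that misses `i` is
    -- charged to `μ`, the part that recommends `i` to `ν`.
    have hsplit : ∑' l, min (A.historyLaw μ T l) (A.historyLaw ν T l) * (1 - A.recommend l i) ≤
        A.errorProb μ T i := by
      refine ENNReal.le_sub_of_add_le_right (PMF.apply_ne_top _ _) ?_
      rw [recommendationLaw, PMF.bind_apply, ← ENNReal.tsum_add]
      refine le_trans (ENNReal.tsum_le_tsum fun l => ?_) (A.historyLaw μ T).tsum_coe.le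
      calc _ ≤ A.historyLaw μ T l * (1 - A.recommend l i) + A.historyLaw μ T l * A.recommend l i :=
            by gcongr; exact min_le_left _ _
        _ = _ := by
            rw [← mul_add, tsub_add_cancel_of_le (PMF.coe_le_one _ _), mul_one]
    have hrest : ∑' l, min (A.historyLaw μ T l) (A.historyLaw ν T l) * A.recommend l i ≤
        A.recommendationLaw ν T i := by
      rw [recommendationLaw, PMF.bind_apply]
      exact ENNReal.tsum_le_tsum fun l => by gcongr; exact min_le_right _ _
    refine le_trans ?_ (add_le_add hsplit hrest)
    rw [← ENNReal.tsum_add]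
    refine ENNReal.tsum_le_tsum fun l => ?_
    rw [← mul_add, tsub_add_cancel_of_le (PMF.coe_le_one _ _), mul_one]
  have h3 := h2.trans (add_le_add_right (A.recommendationLaw_le_errorProb ν T hij) _)
  rw [ENNReal.ofReal_div_of_pos two_pos, ENNReal.ofReal_pow hρ0, mul_comm, pow_mul]
  refine ENNReal.div_le_of_le_mul ?_
  rw [mul_comm _ (ENNReal.ofReal 2)]
  simpa using h1.trans (mul_le_mul_right h3 _)

end BAIPolicy

/-! ### The weight of small gaps -/

section

/-- The regret caused by two arms with means `m < x` at distance at most `1 / √T`, which no policy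
tells apart reliably within `T` rounds. -/
def gapWeight (T : ℕ) (x m : I) : ENNReal :=
  {q : I × I | q.2 < q.1 ∧ T * ((q.1 : ℝ) - q.2) ^ 2 ≤ 1}.indicator
    (fun q => ENNReal.ofReal ((q.1 : ℝ) - q.2) *
      ENNReal.ofReal (bernoulliAffinity q.1 q.2 ^ (2 * T) / 2)) (x, m)

theorem measurableSet_smallGap (T : ℕ) :
    MeasurableSet {q : I × I | q.2 < q.1 ∧ T * ((q.1 : ℝ) - q.2) ^ 2 ≤ 1} := by
  have h : Measurable fun q : I × I => T * ((q.1 : ℝ) - q.2) ^ 2 := by fun_prop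
  exact (measurableSet_lt measurable_snd measurable_fst).inter (measurableSet_le h measurable_const)

theorem measurable_gapWeight (T : ℕ) : Measurable fun q : I × I => gapWeight T q.1 q.2 := by
  have h : Measurable fun q : I × I => ENNReal.ofReal ((q.1 : ℝ) - q.2) *
      ENNReal.ofReal (bernoulliAffinity q.1 q.2 ^ (2 * T) / 2) := by
    unfold bernoulliAffinity
    fun_prop
  exact h.indicator (measurableSet_smallGap T)

/-- The total gap of the pairs of means at distance at most `1 / √T`. -/
theorem lintegral_smallGap_le (T : ℕ) (hT : 1 ≤ T) :
    ∫⁻ q : I × I, {q : I × I | q.2 < q.1 ∧ T * ((q.1 : ℝ) - q.2) ^ 2 ≤ 1}.indicator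
      (fun q => ENNReal.ofReal ((q.1 : ℝ) - q.2)) q ≤ ENNReal.ofReal (1 / T) := by
  have hT0 : (0 : ℝ) < T := by exact_mod_cast hT
  set s : ℝ := √(1 / T) with hs
  have hs0 : 0 ≤ s := Real.sqrt_nonneg _
  have hss : s * s = 1 / T := Real.mul_self_sqrt (by positivity)
  have hle : ∀ d : ℝ, T * d ^ 2 ≤ 1 → d ≤ s := by
    intro d hd
    refine Real.le_sqrt_of_sq_le ?_
    rw [le_div_iff₀ hT0]
    linarith
  rw [Measure.volume_eq_prod, lintegral_prod_symm _
    ((Measurable.indicator (by fun_prop) (measurableSet_smallGap T)).aemeasurable)]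
  have hinner : ∀ m : I, ∫⁻ x : I, {q : I × I | q.2 < q.1 ∧ T * ((q.1 : ℝ) - q.2) ^ 2 ≤ 1}.indicator
      (fun q => ENNReal.ofReal ((q.1 : ℝ) - q.2)) (x, m) ≤ ENNReal.ofReal (1 / T) := by
    intro m
    -- For fixed `m` the gap is at most `s = 1/√T` on an interval of length `s`, which contributes
    -- at most `s² = 1/T`.
    have hvol : volume {x : I | (x : ℝ) ∈ Set.Icc (m : ℝ) (m + s)} ≤ ENNReal.ofReal s := by
      rw [unitInterval.volume_apply]
      refine (measure_mono (t := Set.Icc (m : ℝ) (m + s)) ?_).trans_eq (by simp)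
      rintro _ ⟨x, hx, rfl⟩
      exact hx
    calc _ ≤ ∫⁻ x : I, {x : I | (x : ℝ) ∈ Set.Icc (m : ℝ) (m + s)}.indicator
          (fun _ => ENNReal.ofReal s) x := by
          refine lintegral_mono fun x => ?_
          by_cases hx : (x, m) ∈ {q : I × I | q.2 < q.1 ∧ T * ((q.1 : ℝ) - q.2) ^ 2 ≤ 1}
          · have h1 := hx.1
            have h2 := hx.2
            have h3 := hle _ h2
            have h4 : (m : ℝ) < x := h1
            have h5 : x ∈ {x : I | (x : ℝ) ∈ Set.Icc (m : ℝ) (m + s)} := ⟨h4.le, by linarith⟩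
            rw [Set.indicator_of_mem hx, Set.indicator_of_mem h5]
            exact ENNReal.ofReal_le_ofReal h3
          · rw [Set.indicator_of_notMem hx]
            exact zero_le
      _ ≤ ENNReal.ofReal s * ENNReal.ofReal s := by
          have hmeas : MeasurableSet {x : I | (x : ℝ) ∈ Set.Icc (m : ℝ) (m + s)} :=
            measurable_subtype_coe measurableSet_Icc
          rw [lintegral_indicator_const hmeas]
          gcongr
      _ = _ := by rw [← ENNReal.ofReal_mul hs0, hss]
  refine (lintegral_mono hinner).trans ?_
  simp

/-! ### Exchanging the means of the two best arms -/

variable {K : ℕ}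

/-- The vectors of means whose best arm is `i` and whose second best arm is `j`. -/
def topPair (i j : Fin K) : Set (Fin K → I) :=
  {μ | μ j < μ i ∧ ∀ k, k ≠ i → k ≠ j → μ k < μ j}

theorem measurableSet_topPair (i j : Fin K) : MeasurableSet (topPair i j) := by
  unfold topPair
  simp only [Set.ofPred_and, Set.ofPred_forall]
  refine (measurableSet_lt (by fun_prop) (by fun_prop)).inter ?_
  refine MeasurableSet.iInter fun k => MeasurableSet.iInter fun _ => MeasurableSet.iInter fun _ => ?_
  exact measurableSet_lt (by fun_prop) (by fun_prop)

/-- The vector of means with the entries `x` and `x'` at `i` and `j`, and `y` elsewhere. -/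
def glueMeans (i j : Fin K) (x x' : I) (y : OtherMeans₂ i j) : Fin K → I :=
  fun k => if hi : k = i then x else if hj : k = j then x' else y ⟨k, hi, hj⟩

section glueMeans

variable {i j : Fin K} (x x' : I) (y : OtherMeans₂ i j)

theorem glueMeans_left : glueMeans i j x x' y i = x := by simp [glueMeans]

theorem glueMeans_right (hij : i ≠ j) : glueMeans i j x x' y j = x' := by
  simp [glueMeans, hij.symm]

theorem glueMeans_other {k : Fin K} (hi : k ≠ i) (hj : k ≠ j) :
    glueMeans i j x x' y k = y ⟨k, hi, hj⟩ := by simp [glueMeans, hi, hj]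

theorem glueMeans_self (μ : Fin K → I) : glueMeans i j (μ i) (μ j) (fun k => μ k) = μ := by
  funext k
  by_cases hi : k = i
  · subst hi
    simp [glueMeans]
  by_cases hj : k = j
  · subst hj
    simp [glueMeans, hi]
  simp [glueMeans, hi, hj]

theorem measurable_glueMeans :
    Measurable fun p : (I × I) × OtherMeans₂ i j => glueMeans i j p.1.1 p.1.2 p.2 := by
  refine measurable_pi_lambda _ fun k => ?_
  unfold glueMeans
  split_ifs <;> fun_prop

theorem glueMeans_swap_mem_topPair (hij : i ≠ j) (h : glueMeans i j x x' y ∈ topPair i j) :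
    glueMeans i j x' x y ∈ topPair j i := by
  obtain ⟨h1, h2⟩ := h
  rw [glueMeans_left, glueMeans_right _ _ _ hij] at h1
  refine ⟨by rwa [glueMeans_left, glueMeans_right _ _ _ hij], fun k hj hi => ?_⟩
  have := h2 k hi hj
  rw [glueMeans_right _ _ _ hij, glueMeans_other _ _ _ hi hj] at this
  rwa [glueMeans_left, glueMeans_other _ _ _ hi hj]

/-- Only arms `i` and `j` are affected by the exchange, and there the coefficient is symmetric;
everywhere else it is 1. -/
theorem bernoulliAffinity_le_glueMeans_swap (hij : i ≠ j) (a : Fin K) :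
    bernoulliAffinity x x' ≤
      bernoulliAffinity (glueMeans i j x x' y a) (glueMeans i j x' x y a) := by
  by_cases hi : a = i
  · subst hi
    rw [glueMeans_left, glueMeans_left]
  by_cases hj : a = j
  · subst hj
    rw [glueMeans_right _ _ _ hij, glueMeans_right _ _ _ hij, bernoulliAffinity_comm]
  rw [glueMeans_other _ _ _ hi hj, glueMeans_other _ _ _ hi hj, bernoulliAffinity_self]
  exact bernoulliAffinity_le_one _ _

end glueMeans

variable {H : Measure (Fin K → I)} {i j : Fin K}

/-- Change of variables along the splitting of `μ` into two coordinates and the rest, which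
`glueMeans` inverts. -/
theorem IsCondDensity₂.lintegral_eq {h : I → I → OtherMeans₂ i j → ℝ} [SFinite H]
    (hh : IsCondDensity₂ H i j h) {F : (Fin K → I) → ENNReal} (hF : Measurable F) :
    ∫⁻ μ, F μ ∂H = ∫⁻ p : (I × I) × OtherMeans₂ i j,
      ENNReal.ofReal (h p.1.1 p.1.2 p.2) * F (glueMeans i j p.1.1 p.1.2 p.2)
        ∂((volume : Measure (I × I)).prod (marginalOthers₂ H i j)) := by
  have hF' : Measurable fun p : (I × I) × OtherMeans₂ i j => F (glueMeans i j p.1.1 p.1.2 p.2) :=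
    hF.comp measurable_glueMeans
  have hm : Measurable fun μ : Fin K → I =>
      ((μ i, μ j), fun k : {k : Fin K // k ≠ i ∧ k ≠ j} => μ k) := by fun_prop
  have h1 := lintegral_map (μ := H) hF' hm
  simp only [glueMeans_self] at h1
  rw [← h1, hh.map_eq, lintegral_withDensity_eq_lintegral_mul _ hh.measurable.ennreal_ofReal hF']
  rfl

/-- Lebesgue measure on the square is invariant under the swap. This puts the regrets of a vector
and of its exchanged copy under one integral, to be compared pointwise. -/
theorem IsCondDensity₂.lintegral_eq_swap {h : I → I → OtherMeans₂ i j → ℝ} [SFinite H]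
    (hh : IsCondDensity₂ H i j h) {F : (Fin K → I) → ENNReal} (hF : Measurable F) :
    ∫⁻ μ, F μ ∂H = ∫⁻ p : (I × I) × OtherMeans₂ i j,
      ENNReal.ofReal (h p.1.2 p.1.1 p.2) * F (glueMeans i j p.1.2 p.1.1 p.2)
        ∂((volume : Measure (I × I)).prod (marginalOthers₂ H i j)) := by
  have : SFinite (marginalOthers₂ H i j) := by unfold marginalOthers₂; infer_instance
  rw [hh.lintegral_eq hF]
  have hs : MeasurePreserving (Prod.map Prod.swap id)
      ((volume : Measure (I × I)).prod (marginalOthers₂ H i j))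
      ((volume : Measure (I × I)).prod (marginalOthers₂ H i j)) :=
    (Measure.measurePreserving_swap (μ := (volume : Measure I)) (ν := (volume : Measure I))).prod
      (MeasurePreserving.id _)
  exact (hs.lintegral_comp
    (hh.measurable.ennreal_ofReal.mul (hF.comp measurable_glueMeans))).symm

/-- The part of the simple regret that is due to missing the best arm `i` when the second best arm
is `j`. -/
def pairRegret (A : BAIPolicy K) (T : ℕ) (i j : Fin K) (μ : Fin K → I) : ENNReal :=
  (topPair i j).indicator
    (fun μ => ENNReal.ofReal ((μ i : ℝ) - μ j) * A.errorProb μ T i) μ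

theorem measurable_pairRegret (A : BAIPolicy K) (T : ℕ) (i j : Fin K) :
    Measurable (pairRegret A T i j) :=
  Measurable.indicator (Measurable.mul (by fun_prop) (A.measurable_errorProb T i))
    (measurableSet_topPair i j)

theorem measurable_indicator_gapWeight (T : ℕ) (i j : Fin K) :
    Measurable ((topPair i j).indicator fun μ : Fin K → I => gapWeight T (μ i) (μ j)) :=
  Measurable.indicator ((measurable_gapWeight T).comp (f := fun μ : Fin K → I => (μ i, μ j))
    (by fun_prop)) (measurableSet_topPair i j)

/-- Exchanging the means of the two best arms hardly changes the prior, while the policy cannot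
tell the two vectors of means apart. -/
theorem lintegral_gapWeight_le [IsProbabilityMeasure H] {h : I → I → OtherMeans₂ i j → ℝ}
    (hij : i ≠ j) (hh : IsCondDensity₂ H i j h) (A : BAIPolicy K) {T : ℕ} (hT : 1 ≤ T) {ε : ℝ}
    (hε : ∀ (y : OtherMeans₂ i j) (x x' : I), T * ((x : ℝ) - x') ^ 2 ≤ 1 →
      h x x' y ≤ h x' x y + ε) :
    ∫⁻ μ, (topPair i j).indicator (fun μ => gapWeight T (μ i) (μ j)) μ ∂H ≤
      ∫⁻ μ, pairRegret A T i j μ ∂H + ∫⁻ μ, pairRegret A T j i μ ∂H +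
        ENNReal.ofReal ε * ENNReal.ofReal (1 / T) := by
  have : IsProbabilityMeasure (marginalOthers₂ H i j) :=
    Measure.isProbabilityMeasure_map (Measurable.aemeasurable (by fun_prop))
  set S : Set (I × I) := {q : I × I | q.2 < q.1 ∧ T * ((q.1 : ℝ) - q.2) ^ 2 ≤ 1} with hS
  set g : I × I → ENNReal := S.indicator (fun q => ENNReal.ofReal ((q.1 : ℝ) - q.2)) with hg
  have hgm : Measurable g := Measurable.indicator (by fun_prop) (measurableSet_smallGap T)
  have hgm1 : Measurable fun p : (I × I) × OtherMeans₂ i j => g p.1 := hgm.comp measurable_fst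
  have hgint : ∫⁻ p : (I × I) × OtherMeans₂ i j, ENNReal.ofReal ε * g p.1
      ∂((volume : Measure (I × I)).prod (marginalOthers₂ H i j)) ≤
      ENNReal.ofReal ε * ENNReal.ofReal (1 / T) := by
    rw [lintegral_const_mul _ hgm1,
      lintegral_prod _ hgm1.aemeasurable]
    simp only [lintegral_const, measure_univ, mul_one]
    gcongr
    exact lintegral_smallGap_le T hT
  have hm1 : Measurable fun p : (I × I) × OtherMeans₂ i j => ENNReal.ofReal (h p.1.1 p.1.2 p.2) *
      pairRegret A T i j (glueMeans i j p.1.1 p.1.2 p.2) := hh.measurable.ennreal_ofReal.mul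
    ((measurable_pairRegret A T i j).comp measurable_glueMeans)
  refine le_trans ?_ (add_le_add_right hgint _)
  rw [hh.lintegral_eq (measurable_indicator_gapWeight T i j),
    hh.lintegral_eq (measurable_pairRegret A T i j),
    hh.lintegral_eq_swap (measurable_pairRegret A T j i), ← lintegral_add_left hm1,
    ← lintegral_add_right _ (hgm1.const_mul _)]
  refine lintegral_mono fun p => ?_
  obtain ⟨⟨x, x'⟩, y⟩ := p
  dsimp only
  by_cases hmem : glueMeans i j x x' y ∈ topPair i j
  swap
  · rw [Set.indicator_of_notMem hmem, mul_zero]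
    exact zero_le
  by_cases hgap : (x, x') ∈ S
  swap
  · rw [Set.indicator_of_mem hmem, gapWeight, glueMeans_left, glueMeans_right _ _ _ hij,
      Set.indicator_of_notMem hgap, mul_zero]
    exact zero_le
  have herr := A.pow_le_errorProb_add_errorProb _ _
    (bernoulliAffinity_le_glueMeans_swap x x' y hij) (bernoulliAffinity_nonneg _ _) T hij
  have hε' : ENNReal.ofReal (h x x' y) ≤ ENNReal.ofReal (h x' x y) + ENNReal.ofReal ε :=
    (ENNReal.ofReal_le_ofReal (hε y x x' hgap.2)).trans ENNReal.ofReal_add_le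
  rw [pairRegret, pairRegret, hg, Set.indicator_of_mem hmem,
    Set.indicator_of_mem (glueMeans_swap_mem_topPair x x' y hij hmem),
    gapWeight, Set.indicator_of_mem hmem]
  simp only [glueMeans_left, glueMeans_right _ _ _ hij]
  rw [Set.indicator_of_mem hgap, Set.indicator_of_mem hgap]
  dsimp only
  have he := A.errorProb_le_one (glueMeans i j x' x y) T j
  set e := A.errorProb (glueMeans i j x x' y) T i
  set e' := A.errorProb (glueMeans i j x' x y) T j
  set d := ENNReal.ofReal ((x : ℝ) - x')
  -- Only the `e'` term needs the density at the exchanged point; since `e' ≤ 1`, the replacement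
  -- costs at most `ε * d`.
  calc _ ≤ ENNReal.ofReal (h x x' y) * (d * (e + e')) := by gcongr
    _ = ENNReal.ofReal (h x x' y) * (d * e) + ENNReal.ofReal (h x x' y) * (d * e') := by ring
    _ ≤ ENNReal.ofReal (h x x' y) * (d * e) +
        (ENNReal.ofReal (h x' x y) + ENNReal.ofReal ε) * (d * e') := by gcongr
    _ = ENNReal.ofReal (h x x' y) * (d * e) + ENNReal.ofReal (h x' x y) * (d * e') +
        ENNReal.ofReal ε * (d * e') := by ring
    _ ≤ _ := by
      gcongr
      exact mul_le_of_le_one_right' he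

end

/-! ### Local asymptotics near a tie and integration over the other means -/

section

/-- Near a mean `m`, the local contribution of the gaps to the regret. -/
theorem eventually_le_lintegral_gapWeight (m : I) (h : I → ℝ) (h0 : ∀ x, 0 ≤ h x)
    (hc : ∀ ε : ℝ, 0 < ε → ∃ δ : ℝ, 0 < δ ∧ ∀ x : I, |(x : ℝ) - m| ≤ δ → |h x - h m| ≤ ε) :
    ∀ᶠ T : ℕ in atTop, ENNReal.ofReal (5 / 12 * ((m : ℝ) * (1 - m) * h m)) ≤
      T * ∫⁻ x : I, ENNReal.ofReal (h x) * gapWeight T x m := by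
  rcases eq_or_ne ((m : ℝ) * (1 - m) * h m) 0 with hz | hz
  · exact Eventually.of_forall fun T => by simp [hz]
  have hm0 : 0 < (m : ℝ) := lt_of_le_of_ne m.2.1 fun e => hz (by simp [← e])
  have hm1 : 0 < 1 - (m : ℝ) := lt_of_le_of_ne (sub_nonneg.2 m.2.2) fun e => hz (by simp [← e])
  have hhm : 0 < h m := lt_of_le_of_ne (h0 m) fun e => hz (by simp [← e])
  obtain ⟨δ, hδ, hcont⟩ := hc (h m / 20) (by positivity)
  set v : ℝ := (m : ℝ) * (1 - m) with hv
  have hv0 : 0 < v := mul_pos hm0 hm1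
  have hv4 : v ≤ 1 / 4 := by nlinarith [sq_nonneg ((m : ℝ) - 1 / 2)]
  set r : ℝ := min δ ((1 - m) / 10) with hr
  have hr0 : 0 < r := lt_min hδ (by positivity)
  have hlim : Tendsto (fun T : ℕ => 3.6 * v / (T : ℝ)) atTop (nhds 0) :=
    tendsto_const_div_atTop_nhds_zero_nat _
  filter_upwards [hlim.eventually_le_const (show (0 : ℝ) < r ^ 2 by positivity),
    eventually_ge_atTop 1] with T hTr hT1
  have hT : (0 : ℝ) < T := by exact_mod_cast hT1
  -- Here `3.6 = 4 * 0.9`: as `1 - x ≥ 0.9 (1 - m)` on the window, the loss `T d² / (4 m (1 - x))`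
  -- is at most `d² / w²`. Also `v ≤ 1/4` gives `T w² ≤ 1`, as `gapWeight` demands.
  set w : ℝ := √(3.6 * v / T) with hw
  have hww : w ^ 2 = 3.6 * v / T := Real.sq_sqrt (by positivity)
  have hw0 : 0 < w := Real.sqrt_pos.2 (by positivity)
  have hwr : w ≤ r := by
    rw [hw, Real.sqrt_le_left hr0.le]
    exact hTr
  have hTw : T * w ^ 2 = 3.6 * v := by rw [hww]; field_simp
  have hwδ : w ≤ δ := hwr.trans (min_le_left _ _)
  have hwm : w ≤ (1 - m) / 10 := hwr.trans (min_le_right _ _)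
  -- The factor `19/20` from the continuity of `h`, times the `1/2` in `gapWeight`.
  set c : ℝ := 19 / 40 * h m with hcdef
  set g : ℝ → ℝ := fun x => c * ((x - m) - (x - m) ^ 3 / w ^ 2) with hg
  have hgint : ∫ x in (m : ℝ)..(m + w), g x = c * (w ^ 2 / 4) := by
    have e : ∫ x in (m : ℝ)..(m + w), g x =
        ∫ x in (m - m : ℝ)..(m + w - m), c * (x - x ^ 3 / w ^ 2) :=
      intervalIntegral.integral_comp_sub_right (fun x => c * (x - x ^ 3 / w ^ 2)) (m : ℝ)
    rw [e, intervalIntegral.integral_const_mul, intervalIntegral.integral_sub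
      (by apply Continuous.intervalIntegrable; fun_prop)
      (by apply Continuous.intervalIntegrable; fun_prop),
      intervalIntegral.integral_div, integral_id, integral_pow]
    field_simp
    norm_num
    ring
  have hgnn : ∀ x ∈ Set.Ioc (m : ℝ) (m + w), 0 ≤ g x := by
    intro x hx
    have h1 : 0 < x - m := by linarith [hx.1]
    have h2 : x - m ≤ w := by linarith [hx.2]
    have h3 : (x - m) ^ 3 / w ^ 2 ≤ x - m := by
      rw [div_le_iff₀ (by positivity)]
      have : (x - m) ^ 2 ≤ w ^ 2 := by gcongr
      nlinarith
    exact mul_nonneg (by positivity) (by linarith)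
  have hpt : ∀ x : I, (Set.Ioc (m : ℝ) (m + w)).indicator (fun x => ENNReal.ofReal (g x)) x ≤
      ENNReal.ofReal (h x) * gapWeight T x m := by
    intro x
    by_cases hx : (x : ℝ) ∈ Set.Ioc (m : ℝ) (m + w)
    swap
    · rw [Set.indicator_of_notMem hx]
      exact zero_le
    have h1 : 0 < (x : ℝ) - m := by linarith [hx.1]
    have h2 : (x : ℝ) - m ≤ w := by linarith [hx.2]
    have h3 : ((x : ℝ) - m) ^ 2 ≤ w ^ 2 := by gcongr
    have hmem : (x, m) ∈ {q : I × I | q.2 < q.1 ∧ T * ((q.1 : ℝ) - q.2) ^ 2 ≤ 1} := by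
      refine ⟨hx.1, ?_⟩
      have : T * ((x : ℝ) - m) ^ 2 ≤ T * w ^ 2 := by gcongr
      dsimp only
      linarith
    rw [Set.indicator_of_mem hx, gapWeight, Set.indicator_of_mem hmem,
      ← ENNReal.ofReal_mul h1.le, ← ENNReal.ofReal_mul (h0 x)]
    refine ENNReal.ofReal_le_ofReal ?_
    have hx1 : 0.9 * (1 - (m : ℝ)) ≤ 1 - x := by linarith
    have hρ := one_sub_le_bernoulliAffinity_pow hm0 (show (x : ℝ) < 1 by linarith) hx.1.le T
    have hρ' : T * ((x : ℝ) - m) ^ 2 / (4 * (m * (1 - x))) ≤ ((x : ℝ) - m) ^ 2 / w ^ 2 := by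
      rw [hww, div_div_eq_mul_div, mul_comm (T : ℝ)]
      refine div_le_div_of_nonneg_left (by positivity) (by positivity) ?_
      nlinarith
    have hhx : 19 / 20 * h m ≤ h x := by
      have := hcont x (by rw [abs_of_pos h1]; linarith)
      linarith [(abs_le.1 this).1]
    have hq : 0 ≤ 1 - ((x : ℝ) - m) ^ 2 / w ^ 2 := by
      rw [sub_nonneg, div_le_one (by positivity)]
      exact h3
    calc g x = 19 / 20 * h m * (((x : ℝ) - m) * ((1 - ((x : ℝ) - m) ^ 2 / w ^ 2) / 2)) := by
          simp only [hg, hcdef]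
          ring
      _ ≤ _ := by
          have : 1 - ((x : ℝ) - m) ^ 2 / w ^ 2 ≤ bernoulliAffinity x m ^ (2 * T) := by linarith
          have hx0 := h0 x
          dsimp only
          gcongr
  have hint : ENNReal.ofReal (c * (w ^ 2 / 4)) ≤
      ∫⁻ x : I, ENNReal.ofReal (h x) * gapWeight T x m := by
    refine le_trans ?_ (lintegral_mono hpt)
    have e : ∫⁻ x : I, (Set.Ioc (m : ℝ) (m + w)).indicator (fun x => ENNReal.ofReal (g x)) x =
        ∫⁻ x in Set.Icc (0 : ℝ) 1,
          (Set.Ioc (m : ℝ) (m + w)).indicator (fun x => ENNReal.ofReal (g x)) x :=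
      lintegral_subtype_comap measurableSet_Icc _
    have hsub : Set.Ioc (m : ℝ) (m + w) ⊆ Set.Icc (0 : ℝ) 1 := fun x hx =>
      ⟨by linarith [hx.1], by linarith [hx.2]⟩
    rw [e, setLIntegral_indicator measurableSet_Ioc, Set.inter_eq_left.2 hsub, ← hgint,
      intervalIntegral.integral_of_le (by linarith), ofReal_integral_eq_lintegral_ofReal]
    · refine IntegrableOn.mono_set (t := Set.Icc (m : ℝ) (m + w)) ?_ Set.Ioc_subset_Icc_self
      exact Continuous.integrableOn_Icc (by fun_prop)
    · exact (ae_restrict_iff' measurableSet_Ioc).2 (Eventually.of_forall hgnn)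
  -- The constant obtained is `(19/40) * (3.6/4) = 0.4275`, which exceeds `5/12`.
  calc _ ≤ ENNReal.ofReal (T * (c * (w ^ 2 / 4))) := by
        refine ENNReal.ofReal_le_ofReal ?_
        have : T * (c * (w ^ 2 / 4)) = c / 4 * (T * w ^ 2) := by ring
        rw [this, hTw, hcdef]
        nlinarith [mul_pos hv0 hhm]
    _ = T * ENNReal.ofReal (c * (w ^ 2 / 4)) := by
        rw [ENNReal.ofReal_mul hT.le, ENNReal.ofReal_natCast]
    _ ≤ _ := by gcongr

variable {K : ℕ} {H : Measure (Fin K → I)} {i : Fin K}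

theorem IsCondDensity.lintegral_eq [SFinite H] {h : I → OtherMeans i → ℝ}
    (hh : IsCondDensity H i h) {F : I → OtherMeans i → ENNReal}
    (hF : Measurable fun p : I × OtherMeans i => F p.1 p.2) :
    ∫⁻ μ, F (μ i) (fun k => μ k) ∂H =
      ∫⁻ y, (∫⁻ x, ENNReal.ofReal (h x y) * F x y) ∂(marginalOthers H i) := by
  have : SFinite (marginalOthers H i) := by unfold marginalOthers; infer_instance
  have hm : Measurable fun μ : Fin K → I => (μ i, fun k : {k : Fin K // k ≠ i} => μ k) := by
    fun_prop
  have h1 := lintegral_map (μ := H) hF hm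
  rw [← h1, hh.map_eq, lintegral_withDensity_eq_lintegral_mul _ hh.measurable.ennreal_ofReal hF,
    lintegral_prod_symm' _ (hh.measurable.ennreal_ofReal.mul hF)]
  rfl

/-- Under a prior with a conditional density, almost surely no other mean equals that of arm `i`. -/
theorem IsCondDensity.ae_ne [SFinite H] {h : I → OtherMeans i → ℝ} (hh : IsCondDensity H i h) :
    ∀ᵐ μ ∂H, ∀ k, k ≠ i → μ k ≠ μ i := by
  have hset : MeasurableSet {p : I × OtherMeans i | ∃ k, p.2 k = p.1} := by
    simp only [Set.ofPred_exists]
    exact MeasurableSet.iUnion fun k => measurableSet_eq_fun (by fun_prop) (by fun_prop)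
  have h1 := hh.lintegral_eq (F := fun x y => {p : I × OtherMeans i | ∃ k, p.2 k = p.1}.indicator
    1 (x, y)) (measurable_one.indicator hset)
  have h2 : ∀ y : OtherMeans i, ∫⁻ x, ENNReal.ofReal (h x y) *
      {p : I × OtherMeans i | ∃ k, p.2 k = p.1}.indicator 1 (x, y) = 0 := by
    intro y
    rw [lintegral_eq_zero_iff']
    · have : ∀ᵐ x : I, x ∉ Set.range y := by
        rw [ae_iff]
        simp only [not_not]
        exact (Set.finite_range y).measure_zero volume
      filter_upwards [this] with x hx
      have hx' : (x, y) ∉ {p : I × OtherMeans i | ∃ k, p.2 k = p.1} := hx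
      rw [Set.indicator_of_notMem hx', mul_zero]
      rfl
    · exact (Measurable.mul (hh.measurable.ennreal_ofReal.comp measurable_prodMk_right)
        ((measurable_one.indicator hset).comp measurable_prodMk_right)).aemeasurable
  simp only [h2, lintegral_zero] at h1
  rw [lintegral_eq_zero_iff'] at h1
  · filter_upwards [h1] with μ hμ
    simpa using hμ
  · exact ((measurable_one.indicator hset).comp
      (f := fun μ : Fin K → I => (μ i, fun k : {k : Fin K // k ≠ i} => μ k))
      (by fun_prop)).aemeasurable

theorem measurable_sup_otherMeans (i : Fin K) :
    Measurable fun y : OtherMeans i => (Finset.univ.sup y : I) := by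
  have : Continuous fun y : OtherMeans i => (Finset.univ.sup y : I) :=
    Continuous.finset_sup_apply fun k _ => continuous_apply k
  exact this.measurable

/-- Being only an inequality, it needs no integrability: the Bochner integral of a non-integrable
function is 0. Hence the integrals in `Copt` need not be shown to converge. -/
theorem ENNReal.ofReal_integral_le_lintegral {α : Type*} [MeasurableSpace α] {μ : Measure α}
    {f : α → ℝ} (hf : ∀ x, 0 ≤ f x) :
    ENNReal.ofReal (∫ x, f x ∂μ) ≤ ∫⁻ x, ENNReal.ofReal (f x) ∂μ := by
  by_cases hi : Integrable f μ
  · exact (ofReal_integral_eq_lintegral_ofReal hi (Eventually.of_forall hf)).le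
  · simp [integral_undef hi]

/-- The expected contribution of arm `i` to the regret, over the draws of its mean, is at least its
share of the constant, asymptotically. -/
theorem IsCondDensity.eventually_le_lintegral_gapWeight [SFinite H] {h : I → OtherMeans i → ℝ}
    (hh : IsCondDensity H i h)
    (hc : ∀ ε : ℝ, 0 < ε → ∃ δ : ℝ, 0 < δ ∧ ∀ (y : OtherMeans i) (x z : I),
      |(x : ℝ) - z| ≤ δ → |h x y - h z y| ≤ ε) {ε : ℝ} (hε : 0 < ε) :
    ∀ᶠ T : ℕ in atTop, ENNReal.ofReal (5 / 12 *
        (∫ y, ((Finset.univ.sup y : I) : ℝ) * (1 - ((Finset.univ.sup y : I) : ℝ)) *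
          h (Finset.univ.sup y) y ∂(marginalOthers H i)) - ε) ≤
      T * ∫⁻ μ, gapWeight T (μ i) (Finset.univ.sup fun k : {k : Fin K // k ≠ i} => μ k) ∂H := by
  set f : OtherMeans i → ℝ := fun y => ((Finset.univ.sup y : I) : ℝ) *
    (1 - ((Finset.univ.sup y : I) : ℝ)) * h (Finset.univ.sup y) y with hf
  have hf0 : ∀ y, 0 ≤ f y := fun y =>
    mul_nonneg (mul_nonneg (Finset.univ.sup y).2.1 (sub_nonneg.2 (Finset.univ.sup y).2.2))
      (hh.nonneg _ _)
  have : SFinite (marginalOthers H i) := by unfold marginalOthers; infer_instance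
  have hmeas : ∀ T : ℕ, Measurable fun p : I × OtherMeans i =>
      gapWeight T p.1 (Finset.univ.sup p.2) := fun T =>
    (measurable_gapWeight T).comp (measurable_fst.prodMk
      ((measurable_sup_otherMeans i).comp measurable_snd))
  have hW : ∀ T : ℕ, T * ∫⁻ μ, gapWeight T (μ i)
      (Finset.univ.sup fun k : {k : Fin K // k ≠ i} => μ k) ∂H =
      ∫⁻ y, (T * ∫⁻ x, ENNReal.ofReal (h x y) * gapWeight T x (Finset.univ.sup y))
        ∂(marginalOthers H i) := by
    intro T
    rw [hh.lintegral_eq (F := fun x y => gapWeight T x (Finset.univ.sup y)) (hmeas T),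
      lintegral_const_mul]
    exact (hh.measurable.ennreal_ofReal.mul (hmeas T)).lintegral_prod_left'
  -- Fatou's lemma: the threshold in `T` of the local estimate depends on `y`, but a pointwise
  -- liminf suffices. The `ε` in the conclusion turns the liminf bound into an eventual one.
  have hlim : ENNReal.ofReal (5 / 12 * ∫ y, f y ∂(marginalOthers H i)) ≤
      liminf (fun T : ℕ => T * ∫⁻ μ, gapWeight T (μ i)
        (Finset.univ.sup fun k : {k : Fin K // k ≠ i} => μ k) ∂H) atTop := by
    simp only [hW]
    refine le_trans ?_ (lintegral_liminf_le fun T => Measurable.const_mul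
      ((hh.measurable.ennreal_ofReal.mul (hmeas T)).lintegral_prod_left') _)
    rw [← integral_const_mul]
    refine (ENNReal.ofReal_integral_le_lintegral fun y => mul_nonneg (by norm_num) (hf0 y)).trans
      (lintegral_mono fun y => ?_)
    refine le_liminf_of_le (by isBoundedDefault) ?_
    refine _root_.eventually_le_lintegral_gapWeight _ (fun x => h x y) (fun x => hh.nonneg x y) ?_
    intro ε hε
    obtain ⟨δ, hδ, H'⟩ := hc ε hε
    exact ⟨δ, hδ, fun x hx => H' y _ _ hx⟩
  rcases le_or_gt (5 / 12 * ∫ y, f y ∂(marginalOthers H i)) ε with hle | hgt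
  · refine Eventually.of_forall fun T => ?_
    rw [ENNReal.ofReal_of_nonpos (by linarith)]
    exact zero_le
  · refine (eventually_lt_of_lt_liminf (lt_of_lt_of_le ?_ hlim)).mono fun T hT => hT.le
    rw [ENNReal.ofReal_lt_ofReal_iff (by linarith)]
    linarith

end

/-! ### From pairs of arms to the Bayesian regret -/

section

variable {K : ℕ}

theorem lt_of_mem_topPair {i j k : Fin K} {μ : Fin K → I} (h : μ ∈ topPair i j) (hk : k ≠ i) :
    μ k < μ i := by
  rcases eq_or_ne k j with rfl | hkj
  · exact h.1
  · exact (h.2 k hk hkj).trans h.1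

theorem eq_of_mem_topPair {i j i' j' : Fin K} {μ : Fin K → I} (h : μ ∈ topPair i j)
    (h' : μ ∈ topPair i' j') : i' = i ∧ j' = j := by
  have hi : i' = i := by
    by_contra hne
    exact lt_asymm (lt_of_mem_topPair h hne) (lt_of_mem_topPair h' (Ne.symm hne))
  subst hi
  refine ⟨rfl, ?_⟩
  by_contra hne
  have hj : j ≠ i' := by rintro rfl; exact lt_irrefl _ h.1
  have hj' : j' ≠ i' := by rintro rfl; exact lt_irrefl _ h'.1
  exact lt_asymm (h.2 j' hj' hne) (h'.2 j hj (Ne.symm hne))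

theorem sum_toReal_recommendationLaw (A : BAIPolicy K) (μ : Fin K → I) (T : ℕ) :
    ∑ j, (A.recommendationLaw μ T j).toReal = 1 := by
  rw [← ENNReal.toReal_sum fun j _ => PMF.apply_ne_top _ _,
    ← tsum_fintype (L := SummationFilter.unconditional _), PMF.tsum_coe, ENNReal.toReal_one]

theorem simpleRegret_eq_sum (A : BAIAlgorithm K) (μ : Fin K → I) (T : ℕ) :
    simpleRegret A μ T = ∑ j, ((A T).recommendationLaw μ T j).toReal *
      (((Finset.univ.sup μ : I) : ℝ) - μ j) := by
  simp only [mul_sub, Finset.sum_sub_distrib, ← Finset.sum_mul, sum_toReal_recommendationLaw,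
    one_mul, simpleRegret]

theorem simpleRegret_nonneg (A : BAIAlgorithm K) (μ : Fin K → I) (T : ℕ) :
    0 ≤ simpleRegret A μ T := by
  rw [simpleRegret_eq_sum]
  refine Finset.sum_nonneg fun j _ => mul_nonneg ENNReal.toReal_nonneg (sub_nonneg.2 ?_)
  exact Finset.le_sup (f := μ) (Finset.mem_univ j)

theorem simpleRegret_le_one (A : BAIAlgorithm K) (μ : Fin K → I) (T : ℕ) :
    simpleRegret A μ T ≤ 1 := by
  have h : 0 ≤ ∑ j, ((A T).recommendationLaw μ T j).toReal * (μ j : ℝ) :=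
    Finset.sum_nonneg fun j _ => mul_nonneg ENNReal.toReal_nonneg (μ j).2.1
  have := (Finset.univ.sup μ : I).2.2
  rw [simpleRegret]
  linarith

theorem measurable_simpleRegret (A : BAIAlgorithm K) (T : ℕ) :
    Measurable fun μ => simpleRegret A μ T := by
  have hsup : Continuous fun μ : Fin K → I => (Finset.univ.sup μ : I) :=
    Continuous.finset_sup_apply fun k _ => continuous_apply k
  refine (measurable_subtype_coe.comp hsup.measurable).sub
    (Finset.measurable_sum _ fun j _ => ?_)
  exact ((A T).measurable_recommendationLaw T j).ennreal_toReal.mul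
    (measurable_subtype_coe.comp (measurable_pi_apply j))

theorem ofReal_bayesSimpleRegret (H : Measure (Fin K → I)) [IsFiniteMeasure H]
    (A : BAIAlgorithm K) (T : ℕ) :
    ENNReal.ofReal (bayesSimpleRegret H A T) = ∫⁻ μ, ENNReal.ofReal (simpleRegret A μ T) ∂H := by
  refine ofReal_integral_eq_lintegral_ofReal ?_
    (Eventually.of_forall fun μ => simpleRegret_nonneg A μ T)
  refine Integrable.of_bound (measurable_simpleRegret A T).aestronglyMeasurable 1
    (Eventually.of_forall fun μ => ?_)
  rw [Real.norm_of_nonneg (simpleRegret_nonneg A μ T)]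
  exact simpleRegret_le_one A μ T

/-- Recommending any arm but the best loses at least the gap to the second best. -/
theorem mul_errorProb_le_simpleRegret (A : BAIAlgorithm K) (T : ℕ) {i j : Fin K} {μ : Fin K → I}
    (h : μ ∈ topPair i j) :
    ENNReal.ofReal ((μ i : ℝ) - μ j) * (A T).errorProb μ T i ≤
      ENNReal.ofReal (simpleRegret A μ T) := by
  set p : Fin K → ℝ := fun k => ((A T).recommendationLaw μ T k).toReal with hp
  have hp0 : ∀ k, 0 ≤ p k := fun k => ENNReal.toReal_nonneg
  have hgap : (0 : ℝ) ≤ (μ i : ℝ) - μ j := sub_nonneg.2 h.1.le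
  have herr : (A T).errorProb μ T i = ENNReal.ofReal (1 - p i) := by
    rw [BAIPolicy.errorProb, ENNReal.ofReal_sub _ (hp0 i), ENNReal.ofReal_one,
      ENNReal.ofReal_toReal (PMF.apply_ne_top _ _)]
  rw [herr, ← ENNReal.ofReal_mul hgap]
  refine ENNReal.ofReal_le_ofReal ?_
  have hsum : ∑ k, (p k * ((μ i : ℝ) - μ j) - if k = i then p i * ((μ i : ℝ) - μ j) else 0) =
      ((μ i : ℝ) - μ j) * (1 - p i) := by
    rw [Finset.sum_sub_distrib, ← Finset.sum_mul, sum_toReal_recommendationLaw,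
      Finset.sum_ite_eq' Finset.univ i]
    simp only [Finset.mem_univ, if_true]
    ring
  rw [simpleRegret_eq_sum, ← hsum]
  refine Finset.sum_le_sum fun k _ => ?_
  have hM : ∀ l, (μ l : ℝ) ≤ (Finset.univ.sup μ : I) := fun l =>
    Finset.le_sup (f := μ) (Finset.mem_univ l)
  split_ifs with hk
  · subst hk
    rw [sub_self]
    exact mul_nonneg (hp0 k) (sub_nonneg.2 (hM k))
  · rw [sub_zero]
    have hkj : (μ k : ℝ) ≤ μ j := by
      rcases eq_or_ne k j with rfl | hkj
      · exact le_rfl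
      · exact (h.2 k hk hkj).le
    exact mul_le_mul_of_nonneg_left (by linarith [hM i]) (hp0 k)

/-- The sets `topPair i j` are disjoint, so at most one summand is nonzero. -/
theorem sum_pairRegret_le_simpleRegret (A : BAIAlgorithm K) (T : ℕ) (μ : Fin K → I) :
    ∑ i, ∑ j, pairRegret (A T) T i j μ ≤ ENNReal.ofReal (simpleRegret A μ T) := by
  by_cases h : ∃ i j, μ ∈ topPair i j
  · obtain ⟨i, j, h⟩ := h
    rw [Finset.sum_eq_single i, Finset.sum_eq_single j, pairRegret, Set.indicator_of_mem h]
    · exact mul_errorProb_le_simpleRegret A T h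
    · exact fun j' _ hj' => Set.indicator_of_notMem (fun h' => hj' (eq_of_mem_topPair h h').2) _
    · simp
    · exact fun i' _ hi' => Finset.sum_eq_zero fun j' _ =>
        Set.indicator_of_notMem (fun h' => hi' (eq_of_mem_topPair h h').1) _
    · simp
  · push Not at h
    simp [pairRegret, h]

/-- The weight vanishes unless `i` is the best arm; without ties the largest other mean then singles
out the second best arm `j`. -/
theorem gapWeight_sup_le_sum (T : ℕ) (hK : 2 ≤ K) {i : Fin K} {μ : Fin K → I}
    (hμ : Function.Injective μ) :
    gapWeight T (μ i) (Finset.univ.sup fun k : {k : Fin K // k ≠ i} => μ k) ≤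
      ∑ j, (topPair i j).indicator (fun μ => gapWeight T (μ i) (μ j)) μ := by
  have : Nontrivial (Fin K) := Fin.nontrivial_iff_two_le.2 hK
  obtain ⟨l, hl⟩ := exists_ne i
  obtain ⟨⟨j, hj⟩, -, hsup⟩ := Finset.exists_mem_eq_sup Finset.univ
    ⟨⟨l, hl⟩, Finset.mem_univ _⟩ fun k : {k : Fin K // k ≠ i} => μ k
  dsimp only at hsup
  rw [hsup]
  by_cases hlt : μ j < μ i
  · have hmem : μ ∈ topPair i j := by
      refine ⟨hlt, fun k hk hkj => lt_of_le_of_ne ?_ fun e => hkj (hμ e)⟩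
      rw [← hsup]
      exact Finset.le_sup (f := fun k : {k : Fin K // k ≠ i} => μ k)
        (Finset.mem_univ (⟨k, hk⟩ : {k : Fin K // k ≠ i}))
    refine le_trans ?_ (Finset.single_le_sum (fun _ _ => zero_le) (Finset.mem_univ j))
    rw [Set.indicator_of_mem hmem]
  · rw [gapWeight, Set.indicator_of_notMem fun h => hlt h.1]
    exact zero_le

/-- The regret dominates, up to an arbitrarily small multiple of `1 / T`, half the total
contribution of the arms. -/
theorem eventually_sum_lintegral_gapWeight_le (hK : 2 ≤ K) {H : Measure (Fin K → I)}
    [IsProbabilityMeasure H] {h₁ : (i : Fin K) → I → OtherMeans i → ℝ}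
    {h₂ : (i j : Fin K) → I → I → OtherMeans₂ i j → ℝ}
    (hH : UniformlyContinuousDensities H h₁ h₂) (A : BAIAlgorithm K) {ε : ℝ} (hε : 0 < ε) :
    ∀ᶠ T : ℕ in atTop, ∑ i, T * ∫⁻ μ, gapWeight T (μ i)
        (Finset.univ.sup fun k : {k : Fin K // k ≠ i} => μ k) ∂H ≤
      2 * T * ENNReal.ofReal (bayesSimpleRegret H A T) + K ^ 2 * ENNReal.ofReal ε := by
  obtain ⟨δ, hδ, hcont⟩ := hH.cont₂ ε hε
  have hinj : ∀ᵐ μ ∂H, Function.Injective μ := by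
    filter_upwards [ae_all_iff.2 fun i => (hH.density₁ i).ae_ne] with μ hμ k i e
    by_contra hne
    exact hμ i k hne e
  -- Once `1/√T ≤ δ`, every exchange within the small-gap region changes the density by at most `ε`.
  have hlim : Tendsto (fun T : ℕ => 1 / (T : ℝ)) atTop (nhds 0) :=
    tendsto_const_div_atTop_nhds_zero_nat _
  filter_upwards [hlim.eventually_le_const (show (0 : ℝ) < δ ^ 2 by positivity),
    eventually_ge_atTop 1] with T hTδ hT1
  have hT : (0 : ℝ) < T := by exact_mod_cast hT1
  set L : Fin K → Fin K → ENNReal := fun i j => ∫⁻ μ, pairRegret (A T) T i j μ ∂H with hL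
  have hLsum : ∑ i, ∑ j, L i j ≤ ENNReal.ofReal (bayesSimpleRegret H A T) := by
    rw [ofReal_bayesSimpleRegret]
    refine le_trans (le_of_eq ?_) (lintegral_mono (sum_pairRegret_le_simpleRegret A T))
    rw [lintegral_finsetSum _ fun i _ =>
      Finset.measurable_sum _ fun j _ => measurable_pairRegret (A T) T i j]
    exact Finset.sum_congr rfl fun i _ =>
      (lintegral_finsetSum _ fun j _ => measurable_pairRegret (A T) T i j).symm
  have hone : (T : ENNReal) * ENNReal.ofReal (1 / T) = 1 := by
    rw [← ENNReal.ofReal_natCast, ← ENNReal.ofReal_mul hT.le, mul_one_div_cancel hT.ne',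
      ENNReal.ofReal_one]
  have hpair : ∀ i j, T * ∫⁻ μ, (topPair i j).indicator (fun μ => gapWeight T (μ i) (μ j)) μ ∂H ≤
      T * (L i j + L j i) + ENNReal.ofReal ε := by
    intro i j
    rcases eq_or_ne i j with rfl | hij
    · have : topPair i i = ∅ := Set.eq_empty_of_forall_notMem fun μ h => lt_irrefl _ h.1
      simp [this]
    have hswap : ∀ (y : OtherMeans₂ i j) (x x' : I), T * ((x : ℝ) - x') ^ 2 ≤ 1 →
        h₂ i j x x' y ≤ h₂ i j x' x y + ε := by
      intro y x x' hx
      have habs : |(x : ℝ) - x'| ≤ δ := by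
        refine abs_le_of_sq_le_sq ?_ hδ.le
        refine le_trans ?_ hTδ
        rw [le_div_iff₀ hT]
        linarith
      have := hcont i j hij y x x' x' x habs (by rwa [abs_sub_comm])
      linarith [(abs_le.1 this).2]
    calc _ ≤ T * (L i j + L j i + ENNReal.ofReal ε * ENNReal.ofReal (1 / T)) := by
          gcongr
          exact lintegral_gapWeight_le hij (hH.density₂ i j hij) (A T) hT1 hswap
      _ = T * (L i j + L j i) + ENNReal.ofReal ε * (T * ENNReal.ofReal (1 / T)) := by ring
      _ = _ := by rw [hone, mul_one]
  calc _ ≤ ∑ i, ∑ j,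
        T * ∫⁻ μ, (topPair i j).indicator (fun μ => gapWeight T (μ i) (μ j)) μ ∂H := by
        refine Finset.sum_le_sum fun i _ => ?_
        rw [← Finset.mul_sum, ← lintegral_finsetSum _ fun j _ =>
          measurable_indicator_gapWeight T i j]
        exact mul_le_mul_right (lintegral_mono_ae
          (hinj.mono fun μ hμ => gapWeight_sup_le_sum T hK hμ)) _
    _ ≤ ∑ i, ∑ j, (T * (L i j + L j i) + ENNReal.ofReal ε) :=
        Finset.sum_le_sum fun i _ => Finset.sum_le_sum fun j _ => hpair i j
    -- Each `L i j` occurs for both orders of the pair, whence the factor 2.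
    _ = T * (∑ i, ∑ j, L i j + ∑ i, ∑ j, L i j) + K ^ 2 * ENNReal.ofReal ε := by
        have hcomm : ∑ i, ∑ j, L j i = ∑ i, ∑ j, L i j := Finset.sum_comm
        simp only [Finset.sum_add_distrib, hcomm, ← Finset.mul_sum, Finset.sum_const, Finset.card_univ,
          Fintype.card_fin, nsmul_eq_mul]
        ring
    _ ≤ T * (ENNReal.ofReal (bayesSimpleRegret H A T) + ENNReal.ofReal (bayesSimpleRegret H A T)) +
        K ^ 2 * ENNReal.ofReal ε := by gcongr
    _ = _ := by ring

theorem eventually_Copt_le (hK : 2 ≤ K) {H : Measure (Fin K → I)}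
    [IsProbabilityMeasure H] {h₁ : (i : Fin K) → I → OtherMeans i → ℝ}
    {h₂ : (i j : Fin K) → I → I → OtherMeans₂ i j → ℝ}
    (hH : UniformlyContinuousDensities H h₁ h₂) (A : BAIAlgorithm K) {ε : ℝ} (hε : 0 < ε) :
    ∀ᶠ T : ℕ in atTop, Copt H h₁ / 4.8 ≤ T * bayesSimpleRegret H A T + ε := by
  -- `K ^ 2` errors come from the ordered pairs and `K` from the local estimates. Halving `5/12`
  -- gives `1/4.8`.
  set ε' : ℝ := ε / (K ^ 2 + K) with hε'
  have hK0 : (0 : ℝ) < K := by exact_mod_cast (by omega : 0 < K)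
  have hε'0 : 0 < ε' := by positivity
  have hc : ∀ i, ∀ ε : ℝ, 0 < ε → ∃ δ : ℝ, 0 < δ ∧ ∀ (y : OtherMeans i) (x z : I),
      |(x : ℝ) - z| ≤ δ → |h₁ i x y - h₁ i z y| ≤ ε := fun i ε hε =>
    (hH.cont₁ ε hε).imp fun δ hδ => ⟨hδ.1, hδ.2 i⟩
  filter_upwards [eventually_sum_lintegral_gapWeight_le hK hH A hε'0,
    eventually_all.2 fun i => (hH.density₁ i).eventually_le_lintegral_gapWeight (hc i) hε'0]
    with T hle hge
  have hR : 0 ≤ bayesSimpleRegret H A T := integral_nonneg fun μ => simpleRegret_nonneg A μ T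
  have h := (Finset.le_sum_of_subadditive ENNReal.ofReal ENNReal.ofReal_zero.le
    (fun _ _ => ENNReal.ofReal_add_le) Finset.univ _).trans
    ((Finset.sum_le_sum fun i (_ : i ∈ Finset.univ) => hge i).trans hle)
  have hrhs : 2 * (T : ENNReal) * ENNReal.ofReal (bayesSimpleRegret H A T) +
      K ^ 2 * ENNReal.ofReal ε' =
      ENNReal.ofReal (2 * T * bayesSimpleRegret H A T + K ^ 2 * ε') := by
    rw [ENNReal.ofReal_add (by positivity) (by positivity), ENNReal.ofReal_mul (by positivity),
      ENNReal.ofReal_mul (by positivity), ENNReal.ofReal_mul (by positivity),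
      ENNReal.ofReal_pow (by positivity)]
    simp
  rw [hrhs, ENNReal.ofReal_le_ofReal_iff (by positivity), Finset.sum_sub_distrib,
    ← Finset.mul_sum] at h
  simp only [Finset.sum_const, Finset.card_univ, Fintype.card_fin, nsmul_eq_mul] at h
  have hεK : (K ^ 2 + K) * ε' = ε := by rw [hε']; field_simp
  have hC : Copt H h₁ = ∑ i, ∫ y, ((Finset.univ.sup y : I) : ℝ) *
      (1 - ((Finset.univ.sup y : I) : ℝ)) * h₁ i (Finset.univ.sup y) y ∂(marginalOthers H i) := rfl
  rw [← hC] at h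
  norm_num
  linarith

end

end

theorem theorem2 (K : ℕ) (hK : 2 ≤ K) (H : Measure (Fin K → I)) [IsProbabilityMeasure H]
    (h₁ : (i : Fin K) → I → OtherMeans i → ℝ)
    (h₂ : (i j : Fin K) → I → I → OtherMeans₂ i j → ℝ)
    (hH : UniformlyContinuousDensities H h₁ h₂)
    (A : BAIAlgorithm K) :
    ∃ r : ℕ → ℝ, r =o[atTop] (fun T : ℕ => 1 / (T : ℝ)) ∧
      ∀ T : ℕ, 1 ≤ T →
        bayesSimpleRegret H A T ≥ Copt H h₁ / (4.8 * (T : ℝ)) - r T := by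
  -- The remainder is the positive part of the shortfall; it is `o(1/T)` because `T` times the
  -- shortfall is eventually below any `c > 0`.
  refine ⟨fun T => max 0 (Copt H h₁ / (4.8 * (T : ℝ)) - bayesSimpleRegret H A T), ?_,
    fun T _ => by linarith [le_max_right 0 (Copt H h₁ / (4.8 * (T : ℝ)) - bayesSimpleRegret H A T)]⟩
  refine isLittleO_iff.2 fun c hc => ?_
  filter_upwards [eventually_Copt_le hK hH A hc, eventually_ge_atTop 1] with T h hT1
  have hT : (0 : ℝ) < T := by exact_mod_cast hT1
  rw [Real.norm_of_nonneg (le_max_left _ _), Real.norm_of_nonneg (by positivity)]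
  refine max_le (by positivity) ?_
  rw [← div_div, sub_le_iff_le_add, div_le_iff₀ hT]
  refine h.trans (le_of_eq ?_)
  field_simp
  ring
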